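/- Let $p$ be a prime, $e\ge 1$, $q=p^e$, and let $m\ge e$ be an integer. The linearized Wenger graph $L_m(q)$ is the bipartite graph whose vertices are two disjoint copies of $\mathbb{F}_q^{m+1}$, the points $P=(p_1,\dots,p_{m+1})$ and the lines $L=[l_1,\dots,l_{m+1}]$, where $P$ and $L$ are adjacent if and only if $$l_k+p_k=p_1^{\,p^{k-2}}\,l_1\qquad\text{for all } k=2,\dots,m+1.$$ For $0\le i\le e$ put $$r_i=\frac{\prod_{j=0}^{e-i-1}(p^e-p^j)^2}{\prod_{j=0}^{e-i-1}(p^{e-i}-p^j)}.$$ Then $L_m(q)$ has exactly $q^{m-e}$ connected components, and the distinct eigenvalues of its adjacency matrix are $$0,\quad \pm\sqrt{q p^i}\quad(0\le i\le e).$$ For $0\le i\le e$, the eigenvalue $\sqrt{qp^i}$ and the eigenvalue $-\sqrt{qp^i}$ each have multiplicity $$q^{m-e}\,p^{e-i}\,r_i .$$ The eigenvalue $0$ has multiplicity $$2\,q^{m-e}\sum_{i=1}^{e}(p^e-p^{e-i})\,r_i .$$ (That is, $q^{m-e}\sum_{i=1}^{e}(p^e-p^{e-i})\,r_i$ for each of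 the two signs when $0$ is listed as $\pm\sqrt{q\cdot 0}$.) -/

import Mathlib

open Finset

/-- The incidence relation between a point `P` and a line `L`, both in `F ^ (m + 1)`:
`L_k + P_k = g_k (P_1, L_1)` for `k = 2, ..., m + 1`. Coordinates are numbered from `0` here, so
the usual coordinate `1` is `0`, and the usual coordinate `k + 2` is `k.succ` for `k : Fin m`. -/
def WengerIncident {F : Type*} [Field F] {m : ℕ} (g : Fin m → MvPolynomial (Fin 2) F)
    (P L : Fin (m + 1) → F) : Prop :=
  ∀ k : Fin m, L k.succ + P k.succ = MvPolynomial.eval ![P 0, L 0] (g k)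

/-- The bipartite graph on two disjoint copies of `F ^ (m + 1)`, the points `Sum.inl P` and the
lines `Sum.inr L`, in which a point and a line are joined when they are incident. -/
def generalWengerGraph {F : Type*} [Field F] {m : ℕ} (g : Fin m → MvPolynomial (Fin 2) F) :
    SimpleGraph ((Fin (m + 1) → F) ⊕ (Fin (m + 1) → F)) where
  Adj
    | Sum.inl P, Sum.inr L => WengerIncident g P L
    | Sum.inr L, Sum.inl P => WengerIncident g P L
    | _, _ => False
  symm := ⟨by rintro (a | a) (b | b) h <;> exact h⟩
  loopless := ⟨by rintro (a | a) h <;> exact h⟩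

/-- The linearized Wenger graph: the polynomials are `x ^ (p ^ k) * y` for `k = 0, ..., m - 1`. -/
noncomputable def linearizedWengerGraph (F : Type*) [Field F] (p m : ℕ) :
    SimpleGraph ((Fin (m + 1) → F) ⊕ (Fin (m + 1) → F)) :=
  generalWengerGraph fun k : Fin m =>
    MvPolynomial.X 0 ^ p ^ (k : ℕ) * MvPolynomial.X 1

/-- `∏_{j < e - i} (p ^ e - p ^ j) ^ 2 / ∏_{j < e - i} (p ^ (e - i) - p ^ j)`. -/
def wengerRankCount (p e i : ℕ) : ℚ :=
  (∏ j ∈ range (e - i), ((p : ℚ) ^ e - (p : ℚ) ^ j) ^ 2) /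
    ∏ j ∈ range (e - i), ((p : ℚ) ^ (e - i) - (p : ℚ) ^ j)

/-!
Let `N` be the incidence matrix of points against lines. The adjacency matrix is
`fromBlocks 0 N Nᵀ 0`, so its characteristic polynomial is that of `N * Nᵀ` evaluated at `X ^ 2`
(`Matrix.charpoly_fromBlocks_zero_diagonal`), and it suffices to diagonalize `N * Nᵀ`.

The number of lines through two points `P` and `P'` depends only on `P - P'`, so `N * Nᵀ` is
diagonalized by the additive characters of `F ^ (m + 1)` (`Matrix.charpoly_translationInvariant`).
For a fixed primitive character `ψ` of `F`, the characters are indexed by pairs `(a, w)` with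
`a ∈ F` and `w ∈ F ^ m`. Let `φ_w` be the linear map `x ↦ ∑ k, w k * x ^ p ^ k` over the prime
field. The eigenvalue of `(a, w)` is `q * |ker φ_w|` if `x ↦ ψ (a * x)` is trivial on `ker φ_w`, and
`0` otherwise (`sum_mul_addChar_eq_wengerSqEigenvalue`).

The multiplicities are then counts. If `|ker φ_w| = p ^ i`, exactly `p ^ (e - i)` elements `a` give
a character that is trivial on the kernel (`AddChar.card_trivial_mul_card`). As `m ≥ e`, the map
`w ↦ φ_w` is surjective onto the endomorphisms of `F` over the prime field
(`linearizedPolynomialMap_surjective`), with fibres of size `q ^ (m - e)`. The number of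
endomorphisms of rank `e - i` is `wengerRankCount p e i`, by a double count of the factorizations
through a space of dimension `e - i` (`card_linearMap_finrank_range_eq`).

The graph is `q`-regular, so the number of its components is the dimension of the kernel of its
Laplacian `q - A`, which is the multiplicity of the eigenvalue `q = √(q * p ^ e)` of `A`.
-/

open scoped Matrix

/-! ### Characteristic polynomials and multiplicities -/

open Polynomial in
/-- Multiplying the characteristic matrix on the right by `fromBlocks X 0 B 1` makes it block
triangular, with diagonal blocks `X ^ 2 - A * B` and `X`. -/
theorem Matrix.charpoly_fromBlocks_zero_diagonal {R n : Type*} [CommRing R] [Fintype n]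
    [DecidableEq n] (A B : Matrix n n R) :
    (Matrix.fromBlocks 0 A B 0).charpoly = (A * B).charpoly.comp (X ^ 2) := by
  have h1 : (Matrix.fromBlocks 0 A B 0).charmatrix *
      Matrix.fromBlocks (Matrix.scalar n (X : R[X])) 0 (B.map C) 1 =
      Matrix.fromBlocks (Matrix.scalar n ((X : R[X]) ^ 2) - (A * B).map C) (-A.map C) 0
        (Matrix.scalar n (X : R[X])) := by
    rw [Matrix.charmatrix_fromBlocks, Matrix.fromBlocks_multiply, Matrix.map_mul]
    have hX : ((0 : Matrix n n R).charmatrix) = Matrix.scalar n (X : R[X]) := by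
      simp [Matrix.charmatrix]
    rw [hX]
    congr 1
    · simp [pow_two, sub_eq_add_neg]
    · simp
    · rw [neg_mul, ← (Matrix.scalar_commute (X : R[X]) (fun r => Commute.all _ r) (B.map C)).eq]
      simp
    · simp
  have h2 : (A * B).charpoly.comp (X ^ 2) =
      (Matrix.scalar n ((X : R[X]) ^ 2) - (A * B).map C).det := by
    rw [Matrix.charpoly, ← coe_compRingHom_apply, RingHom.map_det]
    congr 1
    ext i j : 1
    by_cases hij : i = j <;> simp [hij, -Matrix.map_mul]
  have h3 := congrArg Matrix.det h1
  rw [Matrix.det_mul, Matrix.det_fromBlocks_zero₁₂, Matrix.det_fromBlocks_zero₂₁, Matrix.det_one,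
    mul_one, ← h2] at h3
  have hreg : IsRegular (Matrix.scalar n (X : R[X])).det := by
    rw [Matrix.scalar_apply, Matrix.det_diagonal, prod_const]
    exact isRegular_X_pow _
  exact hreg.right h3

open Polynomial in
/-- A factor `X ^ 2 - μ ^ 2` has the simple root `μ` if `μ ≠ 0` and the double root `0` otherwise. -/
theorem Polynomial.rootMultiplicity_prod_X_sq_sub_C {ι : Type*} [Fintype ι] (a : ι → ℝ) (μ : ℝ) :
    (∏ c, (X ^ 2 - C (a c))).rootMultiplicity μ =
      (if μ = 0 then 2 else 1) * #{c | a c = μ ^ 2} := by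
  classical
  have hne : ∀ c, (X ^ 2 - C (a c)) ≠ 0 := fun c => X_pow_sub_C_ne_zero (by norm_num) _
  rw [← count_roots, roots_prod _ _ (prod_ne_zero_iff.mpr fun c _ => hne c), Multiset.count_bind]
  have : ∀ c, ((X ^ 2 - C (a c)).roots.count μ) =
      if a c = μ ^ 2 then (if μ = 0 then 2 else 1) else 0 := fun c => by
    rw [count_roots]
    by_cases h : a c = μ ^ 2
    · have h2 : (X ^ 2 - C (a c)) = (X - C μ) * (X - C (-μ)) := by
        rw [h]; simp only [C_pow, C_neg]; ring
      rw [h2, rootMultiplicity_mul (h2 ▸ hne c), rootMultiplicity_X_sub_C, rootMultiplicity_X_sub_C,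
        if_pos rfl, if_pos h]
      by_cases h0 : μ = 0
      · simp [h0]
      · rw [if_neg h0, if_neg]
        intro h1; exact h0 (by linarith)
    · rw [if_neg h, rootMultiplicity_eq_zero]
      intro h1; apply h
      simp [IsRoot, sub_eq_zero] at h1
      exact h1.symm
  rw [Finset.sum_map_val, sum_congr rfl fun c _ => this c]
  rw [← sum_filter, sum_const, smul_eq_mul, mul_comm]

/-- A symmetric matrix `B` satisfies `ker (B ^ 2) = ker B`, so its generalized eigenspaces are
eigenspaces. -/
theorem Matrix.finrank_eigenspace_eq_rootMultiplicity {n : Type*} [Fintype n] [DecidableEq n]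
    (A : Matrix n n ℝ) (hA : A.IsSymm) (μ : ℝ) :
    Module.finrank ℝ (Module.End.eigenspace (Matrix.toLin' A) μ) =
      A.charpoly.rootMultiplicity μ := by
  set B := A - Matrix.scalar n μ with hB
  have hBs : B.IsSymm := by
    rw [hB, Matrix.IsSymm, Matrix.transpose_sub, hA.eq, Matrix.scalar_apply,
      Matrix.diagonal_transpose]
  have hker : ∀ x, B *ᵥ (B *ᵥ x) = 0 → B *ᵥ x = 0 := fun x hx => by
    rw [← dotProduct_self_eq_zero, Matrix.dotProduct_mulVec, ← Matrix.mulVec_transpose, hBs.eq, hx,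
      zero_dotProduct]
  have hlin : ∀ x, (Matrix.toLin' A - μ • (1 : Module.End ℝ (n → ℝ))) x = B *ᵥ x := fun x => by
    rw [hB, Matrix.sub_mulVec, Matrix.scalar_apply]
    ext i
    simp
  rw [← Matrix.charpoly_toLin', ← LinearMap.finrank_maxGenEigenspace_eq]
  suffices h : Module.End.eigenspace (Matrix.toLin' A) μ =
      Module.End.maxGenEigenspace (Matrix.toLin' A) μ by rw [h]
  refine le_antisymm (Module.End.genEigenspace _ _ |>.mono le_top) fun x hx => ?_
  obtain ⟨k, hk⟩ := Module.End.mem_maxGenEigenspace _ _ _ |>.mp hx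
  rw [Module.End.eigenspace_def, LinearMap.mem_ker, hlin]
  have : ∀ k : ℕ, ((Matrix.toLin' A - μ • (1 : Module.End ℝ (n → ℝ))) ^ (k + 1)) x = 0 →
      B *ᵥ x = 0 := fun k => by
    induction k with
    | zero => intro h; rwa [zero_add, pow_one, hlin] at h
    | succ k ih =>
      intro h
      apply ih
      rw [pow_succ', Module.End.mul_apply, pow_succ', Module.End.mul_apply, hlin, hlin] at h
      rw [pow_succ', Module.End.mul_apply, hlin]
      exact hker _ h
  exact this k (by rw [pow_succ', Module.End.mul_apply, hk, map_zero])

/-! ### Additive characters and translation-invariant matrices -/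

theorem AddChar.sum_dotProduct {F ι : Type*} [Field F] [Fintype F] [Fintype ι] [DecidableEq ι]
    [DecidableEq F] {ψ : AddChar F ℂ} (hψ : ψ.IsPrimitive) (u : ι → F) :
    ∑ c : ι → F, ψ (c ⬝ᵥ u) = if u = 0 then (Fintype.card (ι → F) : ℂ) else 0 := by
  split_ifs with h
  · simp [h]
  · obtain ⟨i, hi⟩ := Function.ne_iff.mp h
    let χ : AddChar (ι → F) ℂ :=
      { toFun := fun c => ψ (c ⬝ᵥ u)
        map_zero_eq_one' := by simp
        map_add_eq_mul' := fun a b => by rw [add_dotProduct, AddChar.map_add_eq_mul] }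
    refine AddChar.sum_eq_zero_of_ne_one (ψ := χ) fun h1 => ?_
    refine hψ hi (AddChar.ext _ _ fun x => ?_)
    have := DFunLike.congr_fun h1 (Pi.single i x)
    simpa [χ, mul_comm] using this

/-- The additive characters of `F ^ ι` form a common eigenbasis of all translation-invariant
matrices, so the eigenvalues of `f (v - v')` are the Fourier coefficients of `f`. -/
theorem Matrix.charpoly_translationInvariant {F ι : Type*} [Field F] [Fintype F] [Fintype ι]
    [DecidableEq ι] [DecidableEq F] {ψ : AddChar F ℂ} (hψ : ψ.IsPrimitive) (f : (ι → F) → ℂ) :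
    (Matrix.of fun v v' : ι → F => f (v - v')).charpoly =
      ∏ c : ι → F, (Polynomial.X - Polynomial.C (∑ u, f u * ψ (c ⬝ᵥ u))) := by
  set M : Matrix (ι → F) (ι → F) ℂ := Matrix.of fun v v' => f (v - v')
  let U : Matrix (ι → F) (ι → F) ℂ := Matrix.of fun v c => ψ (-(c ⬝ᵥ v))
  let V : Matrix (ι → F) (ι → F) ℂ := Matrix.of fun c v => ψ (c ⬝ᵥ v)
  have hq : (Fintype.card (ι → F) : ℂ) ≠ 0 := by simp
  have hUV : U * ((Fintype.card (ι → F) : ℂ)⁻¹ • V) = 1 := by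
    ext v v'
    have : ∀ c : ι → F, U v c * V c v' = ψ (c ⬝ᵥ (v' - v)) := fun c => by
      simp only [U, V, Matrix.of_apply]
      rw [← AddChar.map_add_eq_mul, dotProduct_sub]
      congr 1; ring
    rw [Matrix.mul_smul, Matrix.smul_apply, Matrix.mul_apply, sum_congr rfl fun c _ => this c,
      AddChar.sum_dotProduct hψ, Matrix.one_apply, smul_eq_mul]
    by_cases h : v = v'
    · simp only [h, sub_self, if_true]; exact inv_mul_cancel₀ hq
    · simp [h, sub_eq_zero, Ne.symm h]
  have hMU : M * U = U * Matrix.diagonal fun c => ∑ u, f u * ψ (c ⬝ᵥ u) := by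
    ext v c
    rw [Matrix.mul_apply, Matrix.mul_diagonal, mul_sum, ← (Equiv.subLeft v).sum_comp]
    refine sum_congr rfl fun u _ => ?_
    simp only [M, U, Matrix.of_apply, Equiv.subLeft_apply, sub_sub_cancel]
    rw [mul_left_comm, ← AddChar.map_add_eq_mul, dotProduct_sub]
    congr 2; ring
  have hM : M = U * Matrix.diagonal (fun c => ∑ u, f u * ψ (c ⬝ᵥ u)) *
      ((Fintype.card (ι → F) : ℂ)⁻¹ • V) := by
    rw [← hMU, mul_assoc, hUV, mul_one]
  rw [hM, Matrix.charpoly_mul_comm, ← mul_assoc, mul_eq_one_comm.mp hUV, one_mul,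
    Matrix.charpoly_diagonal]

/-- Orthogonality relation `|V| * |Vᗮ| = |F|`, from summing `ψ (a * x)` over `a : F` and `x ∈ V` in
both orders. -/
theorem AddChar.card_trivial_mul_card {F : Type*} [Field F] [Fintype F] [DecidableEq F]
    {ψ : AddChar F ℂ} (hψ : ψ.IsPrimitive) (V : AddSubgroup F) :
    Nat.card {a : F // ∀ x ∈ V, ψ (a * x) = 1} * Nat.card V = Fintype.card F := by
  classical
  let χ (a : F) : AddChar V ℂ := (AddChar.mulShift ψ a).compAddMonoidHom V.subtype
  have hχ (a : F) : χ a = 0 ↔ ∀ x ∈ V, ψ (a * x) = 1 := by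
    rw [DFunLike.ext_iff, Subtype.forall]; rfl
  have h1 (a : F) : ∑ x : V, ψ (a * x) =
      if ∀ x ∈ V, ψ (a * x) = 1 then (Fintype.card V : ℂ) else 0 := by
    have := AddChar.sum_eq_ite (χ a)
    simp only [hχ] at this
    exact this
  have h2 (x : V) : ∑ a : F, ψ (a * x) = if x = 0 then (Fintype.card F : ℂ) else 0 := by
    have := AddChar.sum_mulShift (x : F) hψ
    simpa using this
  have h4 : ({x : V | x = 0} : Finset V) = {0} := by ext; simp
  have h3 : ∑ a : F, ∑ x : V, ψ (a * x) = ∑ x : V, ∑ a : F, ψ (a * x) := sum_comm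
  simp only [h1, h2, ← sum_filter, sum_const, h4, card_singleton, one_smul, nsmul_eq_mul] at h3
  rw [Nat.card_eq_fintype_card, Nat.card_eq_fintype_card, Fintype.card_subtype]
  exact_mod_cast h3

/-! ### Counting linear maps of given rank -/

/-- A functional on `K ^ r` that vanishes on the range is a linear relation between the `d j`. -/
theorem LinearIndependent.surjective_pi {K V : Type*} [Field K] [AddCommGroup V] [Module K V]
    {r : ℕ} {d : Fin r → Module.Dual K V} (hd : LinearIndependent K d) :
    Function.Surjective (LinearMap.pi d) := by
  rw [← LinearMap.range_eq_top]
  by_contra h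
  obtain ⟨g, hg0, hg⟩ := Submodule.exists_le_ker_of_lt_top _ (lt_top_iff_ne_top.mpr h)
  apply hg0
  have hsum : ∑ j, g (Pi.single j 1) • d j = 0 := by
    ext x
    have hx : g (LinearMap.pi d x) = 0 := hg ⟨x, rfl⟩
    have hsingle (i : Fin r) : (fun j => if i = j then 1 else 0) = (Pi.single i 1 : Fin r → K) := by
      ext j; simp [Pi.single_apply, eq_comm]
    rw [LinearMap.pi_apply_eq_sum_univ] at hx
    simpa [mul_comm, hsingle] using hx
  have := Fintype.linearIndependent_iff.mp hd _ hsum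
  refine LinearMap.pi_ext' fun j => LinearMap.ext_ring ?_
  simpa using this j

/-- Both sides count pairs `(f, u)`, where `f` has rank `r` and `u` is a basis of its range. Such a
pair is the same as a pair of independent families, `u` in `W` and the coordinates `d` of `f` with
respect to `u` in the dual of `V`. -/
theorem card_linearMap_finrank_range_eq {K V W : Type*} [Field K] [Fintype K] [AddCommGroup V]
    [Module K V] [Finite V] [AddCommGroup W] [Module K W] [Finite W] {r : ℕ}
    (hV : r ≤ Module.finrank K V) (hW : r ≤ Module.finrank K W) :
    Nat.card {f : V →ₗ[K] W // Module.finrank K (LinearMap.range f) = r} *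
        ∏ j : Fin r, (Fintype.card K ^ r - Fintype.card K ^ (j : ℕ)) =
      (∏ j : Fin r, (Fintype.card K ^ Module.finrank K V - Fintype.card K ^ (j : ℕ))) *
        ∏ j : Fin r, (Fintype.card K ^ Module.finrank K W - Fintype.card K ^ (j : ℕ)) := by
  classical
  have : Finite (V →ₗ[K] W) := Finite.of_injective _ DFunLike.coe_injective
  have : Finite (Module.Dual K V) := Finite.of_injective _ DFunLike.coe_injective
  have hdual : Module.finrank K (Module.Dual K V) = Module.finrank K V := Subspace.dual_finrank_eq
  let S := Σ f : {f : V →ₗ[K] W // Module.finrank K (LinearMap.range f) = r},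
    {s : Fin r → LinearMap.range f.1 // LinearIndependent K s}
  have hS : Nat.card S =
      Nat.card {f : V →ₗ[K] W // Module.finrank K (LinearMap.range f) = r} *
        ∏ j : Fin r, (Fintype.card K ^ r - Fintype.card K ^ (j : ℕ)) := by
    have hf (f : {f : V →ₗ[K] W // Module.finrank K (LinearMap.range f) = r}) :
        Nat.card {s : Fin r → LinearMap.range f.1 // LinearIndependent K s} =
          ∏ j : Fin r, (Fintype.card K ^ r - Fintype.card K ^ (j : ℕ)) := by
      rw [card_linearIndependent f.2.ge, f.2]
    have := Fintype.ofFinite {f : V →ₗ[K] W // Module.finrank K (LinearMap.range f) = r}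
    rw [Nat.card_sigma, Fintype.sum_congr _ _ hf, sum_const, Finset.card_univ, smul_eq_mul,
      Nat.card_eq_fintype_card]
  rw [← hS, ← card_linearIndependent hW, ← hdual, ← card_linearIndependent (hdual ▸ hV),
    ← Nat.card_prod]
  have hrange (f : {f : V →ₗ[K] W // Module.finrank K (LinearMap.range f) = r})
      (s : Fin r → LinearMap.range f.1) (hs : LinearIndependent K s) :
      Submodule.span K (Set.range s) = ⊤ :=
    hs.span_eq_top_of_card_eq_finrank' (by simp [f.2])
  refine Nat.card_congr (Equiv.ofBijective (fun x : S =>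
    (⟨fun j => (Module.Basis.mk x.2.2 (hrange _ _ x.2.2).ge).coord j ∘ₗ x.1.1.rangeRestrict, ?_⟩,
      ⟨fun j => (x.2.1 j : W), ?_⟩)) ⟨?_, ?_⟩)
  · rw [Fintype.linearIndependent_iff]
    intro g hg j
    obtain ⟨v, hv⟩ := x.1.1.surjective_rangeRestrict (x.2.1 j)
    have h1 := LinearMap.congr_fun hg v
    have h2 (i : Fin r) : (Module.Basis.mk x.2.2 (hrange _ _ x.2.2).ge).repr (x.2.1 j) i =
        if j = i then 1 else 0 := by
      have := Module.Basis.repr_self_apply (Module.Basis.mk x.2.2 (hrange _ _ x.2.2).ge) j i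
      rwa [Module.Basis.mk_apply] at this
    simp only [LinearMap.sum_apply, LinearMap.smul_apply, LinearMap.comp_apply, hv,
      Module.Basis.coord_apply, h2] at h1
    simpa using h1
  · exact x.2.2.map' _ (Submodule.ker_subtype _)
  · -- Injectivity: `f` is recovered from the image pair `(d, u)` as `v ↦ ∑ j, d j v • u j`.
    rintro ⟨⟨f, hf⟩, s, hs⟩ ⟨⟨f', hf'⟩, s', hs'⟩ h
    simp only [Prod.mk.injEq, Subtype.mk.injEq] at h
    obtain ⟨h1, h2⟩ := h
    replace h1 := congrFun h1
    replace h2 := congrFun (Subtype.mk.inj h2)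
    have key (f : V →ₗ[K] W) (s : Fin r → LinearMap.range f) (hs : LinearIndependent K s)
        (hsp : ⊤ ≤ Submodule.span K (Set.range s)) (v : V) :
        f v = ∑ j, ((Module.Basis.mk hs hsp).coord j ∘ₗ f.rangeRestrict) v • (s j : W) := by
      have := congrArg Subtype.val ((Module.Basis.mk hs hsp).sum_repr (f.rangeRestrict v))
      simpa using this.symm
    have hff : f = f' := by
      ext v
      rw [key f s hs (hrange ⟨f, hf⟩ s hs).ge, key f' s' hs' (hrange ⟨f', hf'⟩ s' hs').ge]
      exact sum_congr rfl fun j _ => by rw [h1 j, h2 j]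
    subst hff
    obtain rfl : s = s' := funext fun j => Subtype.ext (h2 j)
    rfl
  · rintro ⟨⟨d, hd⟩, u, hu⟩
    let f : V →ₗ[K] W := Fintype.linearCombination K u ∘ₗ LinearMap.pi d
    have hfr : LinearMap.range f = Submodule.span K (Set.range u) := by
      rw [LinearMap.range_comp, LinearMap.range_eq_top.mpr hd.surjective_pi, Submodule.map_top,
        Fintype.range_linearCombination]
    have hmem (j : Fin r) : u j ∈ LinearMap.range f :=
      hfr ▸ Submodule.subset_span (Set.mem_range_self j)
    have hf : Module.finrank K (LinearMap.range f) = r := by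
      rw [hfr, finrank_span_eq_card hu, Fintype.card_fin]
    have hs : LinearIndependent K fun j => (⟨u j, hmem j⟩ : LinearMap.range f) :=
      LinearIndependent.of_comp (LinearMap.range f).subtype hu
    refine ⟨⟨⟨f, hf⟩, ⟨_, hs⟩⟩, ?_⟩
    simp only [Prod.mk.injEq, Subtype.mk.injEq, and_true]
    ext j v
    have hv : f.rangeRestrict v =
        ∑ i, d i v • Module.Basis.mk hs (hrange ⟨f, hf⟩ _ hs).ge i := by
      ext
      simp [f, Fintype.linearCombination_apply]
    rw [LinearMap.comp_apply, hv]
    rw [map_sum, sum_congr rfl fun i _ => by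
      rw [map_smul, Module.Basis.coord_apply, Module.Basis.repr_self_apply]]
    simp

/-- All fibres of a surjective homomorphism of finite groups have the same size. -/
theorem AddMonoidHom.card_subtype_comp_mul_card {G H : Type*} [AddGroup G] [Finite G]
    [AddGroup H] [Finite H] (φ : G →+ H) (hφ : Function.Surjective φ) (P : H → Prop) :
    Nat.card {g // P (φ g)} * Nat.card H = Nat.card G * Nat.card {h // P h} := by
  classical
  have := Fintype.ofFinite G
  have := Fintype.ofFinite H
  have hfib (h : H) : #{g | φ g = h} = #{g | φ g = 0} :=
    AddMonoidHom.card_fiber_eq_of_mem_range φ (hφ h) (hφ 0)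
  have hsum (s : Finset H) : #{g | φ g ∈ s} = #s * #{g | φ g = 0} := by
    rw [card_eq_sum_card_fiberwise (t := s) (f := φ) (fun g hg => by simpa using hg),
      sum_congr rfl fun h hh => ?_, sum_const, smul_eq_mul]
    rw [filter_filter, ← hfib h]
    congr 1
    ext g
    simp only [mem_filter, mem_univ, true_and, and_iff_right_iff_imp]
    exact fun h' => h' ▸ hh
  have h1 := hsum univ
  have h2 := hsum {h | P h}
  simp only [mem_univ, filter_true, card_univ, mem_filter, true_and] at h1 h2
  rw [Nat.card_eq_fintype_card, Nat.card_eq_fintype_card, Nat.card_eq_fintype_card,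
    Nat.card_eq_fintype_card, Fintype.card_subtype, Fintype.card_subtype, h1, h2]
  ring

/-! ### Linearized polynomials -/

section LinearizedPolynomial

theorem finrank_zmod_eq_of_card_eq {F : Type*} [Field F] [Fintype F] {p e : ℕ} [Fact p.Prime]
    [Algebra (ZMod p) F] (hF : Fintype.card F = p ^ e) :
    Module.finrank (ZMod p) F = e := by
  have := Module.card_eq_pow_finrank (K := ZMod p) (V := F)
  rw [hF, ZMod.card] at this
  exact (Nat.pow_right_injective (Fact.out : p.Prime).two_le this).symm

variable {F : Type*} [Field F] {p : ℕ} [Fact p.Prime] [CharP F p] [Algebra (ZMod p) F]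

/-- The `p`-linearized polynomial `∑ k, w k * x ^ p ^ k`, as a map that is linear over the prime
field, depending additively on its coefficients `w`. -/
def linearizedPolynomialMap (F : Type*) [Field F] (p : ℕ) [Fact p.Prime] [CharP F p]
    [Algebra (ZMod p) F] (m : ℕ) : (Fin m → F) →+ (F →ₗ[ZMod p] F) where
  toFun w := AddMonoidHom.toZModLinearMap p
    { toFun x := ∑ k, w k * x ^ p ^ (k : ℕ)
      map_zero' := by simp [(Fact.out : p.Prime).ne_zero]
      map_add' x y := by simp [add_pow_char_pow, mul_add, sum_add_distrib] }
  map_zero' := by ext; simp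
  map_add' w w' := by ext x; simp [add_mul, sum_add_distrib]

theorem linearizedPolynomialMap_apply {m : ℕ} (w : Fin m → F) (x : F) :
    linearizedPolynomialMap F p m w x = ∑ k, w k * x ^ p ^ (k : ℕ) := rfl

open Polynomial in
/-- With `e` coefficients the polynomial has degree less than `|F|`, so it cannot vanish on `F`
unless it is zero. -/
theorem linearizedPolynomialMap_injective [Fintype F] {e : ℕ} (hF : Fintype.card F = p ^ e) :
    Function.Injective (linearizedPolynomialMap F p e) := by
  have hp : p.Prime := Fact.out
  rw [injective_iff_map_eq_zero]
  intro w hw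
  let P : F[X] := ∑ k, C (w k) * X ^ p ^ (k : ℕ)
  have hP : P = 0 := by
    refine eq_zero_of_natDegree_lt_card_of_eval_eq_zero P (f := id) Function.injective_id
      (fun x => ?_) ?_
    · simpa [P, eval_finsetSum, linearizedPolynomialMap_apply] using LinearMap.congr_fun hw x
    · rw [hF, Nat.lt_iff_le_pred (pow_pos hp.pos _)]
      refine natDegree_sum_le_of_forall_le _ _ fun k _ => (natDegree_C_mul_X_pow_le _ _).trans ?_
      exact Nat.le_pred_of_lt (Nat.pow_lt_pow_right hp.one_lt k.2)
  ext k
  have := congrArg (fun Q => Q.coeff (p ^ (k : ℕ))) hP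
  simpa [P, coeff_X_pow, Nat.pow_right_inj hp.two_le, ← Fin.ext_iff] using this

/-- Every `p`-linear map on `F` is a linearized polynomial: for `m = e` by injectivity and a count,
for larger `m` by padding the coefficients with zeros. -/
theorem linearizedPolynomialMap_surjective [Fintype F] {e m : ℕ} (hF : Fintype.card F = p ^ e)
    (hm : e ≤ m) : Function.Surjective (linearizedPolynomialMap F p m) := by
  have hfr := finrank_zmod_eq_of_card_eq (p := p) hF
  have : Finite (F →ₗ[ZMod p] F) := Finite.of_injective _ DFunLike.coe_injective
  have hcard : Nat.card (Fin e → F) = Nat.card (F →ₗ[ZMod p] F) := by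
    rw [Module.natCard_eq_pow_finrank (K := ZMod p) (V := F →ₗ[ZMod p] F),
      Module.finrank_linearMap, hfr, Nat.card_fun, Nat.card_zmod, Nat.card_eq_fintype_card, hF]
    simp [pow_mul]
  have hbij := (linearizedPolynomialMap_injective (p := p) hF).bijective_of_nat_card_le hcard.ge
  intro f
  obtain ⟨w, rfl⟩ := hbij.2 f
  obtain ⟨d, rfl⟩ := Nat.exists_eq_add_of_le hm
  refine ⟨Fin.append w 0, LinearMap.ext fun x => ?_⟩
  simp [linearizedPolynomialMap_apply, Fin.sum_univ_add]

end LinearizedPolynomial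

/-! ### The characteristic polynomial of the linearized Wenger graph -/

section CharacteristicPolynomial

theorem Fintype.sum_fin_cons {F M : Type*} [Fintype F] [AddCommMonoid M] {m : ℕ}
    (g : (Fin (m + 1) → F) → M) : ∑ u, g u = ∑ x : F, ∑ t : Fin m → F, g (Fin.cons x t) := by
  rw [← (Fin.consEquiv fun _ : Fin (m + 1) => F).sum_comp, Fintype.sum_prod_type]
  rfl

variable {F : Type*} [Field F] {p m : ℕ}

theorem wengerIncident_linearized_iff (P L : Fin (m + 1) → F) :
    WengerIncident (fun k : Fin m => MvPolynomial.X 0 ^ p ^ (k : ℕ) * MvPolynomial.X 1) P L ↔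
      ∀ k : Fin m, L k.succ + P k.succ = P 0 ^ p ^ (k : ℕ) * L 0 := by
  simp [WengerIncident]

variable [DecidableEq F]

/-- The incidence matrix of points against lines, with the incidence relation written out in
coordinates. -/
def wengerIncMatrix (F : Type*) [Field F] [DecidableEq F] (p m : ℕ) :
    Matrix (Fin (m + 1) → F) (Fin (m + 1) → F) ℝ :=
  Matrix.of fun P L => if ∀ k : Fin m, L k.succ + P k.succ = P 0 ^ p ^ (k : ℕ) * L 0 then 1 else 0

theorem adjMatrix_linearizedWengerGraph [DecidableRel (linearizedWengerGraph F p m).Adj] :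
    (linearizedWengerGraph F p m).adjMatrix ℝ =
      Matrix.fromBlocks 0 (wengerIncMatrix F p m) (wengerIncMatrix F p m)ᵀ 0 := by
  ext (P | L) (P' | L')
  · rw [SimpleGraph.adjMatrix_apply]; exact if_neg id
  · simp only [SimpleGraph.adjMatrix_apply, Matrix.fromBlocks_apply₁₂, wengerIncMatrix,
      Matrix.of_apply]
    exact if_congr (wengerIncident_linearized_iff P L') rfl rfl
  · simp only [SimpleGraph.adjMatrix_apply, Matrix.fromBlocks_apply₂₁, wengerIncMatrix,
      Matrix.of_apply, Matrix.transpose_apply]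
    exact if_congr (wengerIncident_linearized_iff P' L) rfl rfl
  · rw [SimpleGraph.adjMatrix_apply]; exact if_neg id

variable [Fintype F]

theorem degree_linearizedWengerGraph [DecidableRel (linearizedWengerGraph F p m).Adj]
    (v : (Fin (m + 1) → F) ⊕ (Fin (m + 1) → F)) :
    ((linearizedWengerGraph F p m).degree v : ℝ) = Fintype.card F := by
  have h : ((linearizedWengerGraph F p m).degree v : ℝ) =
      ∑ w, (linearizedWengerGraph F p m).adjMatrix ℝ v w := by
    rw [SimpleGraph.degree_eq_sum_if_adj]
    rfl
  rw [h, adjMatrix_linearizedWengerGraph]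
  rcases v with P | L
  · have key (x : F) (t : Fin m → F) :
        (∀ k : Fin m, t k + P k.succ = P 0 ^ p ^ (k : ℕ) * x) ↔
          t = fun k : Fin m => P 0 ^ p ^ (k : ℕ) * x - P k.succ := by
      simp only [funext_iff, eq_sub_iff_add_eq]
    simp only [Fintype.sum_sum_type, Matrix.fromBlocks_apply₁₁, Matrix.fromBlocks_apply₁₂,
      Matrix.zero_apply, sum_const_zero, zero_add, wengerIncMatrix, Matrix.of_apply,
      Fintype.sum_fin_cons, Fin.cons_succ, Fin.cons_zero, key, sum_ite_eq', mem_univ, if_true]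
    simp
  · have key (x : F) (t : Fin m → F) :
        (∀ k : Fin m, L k.succ + t k = x ^ p ^ (k : ℕ) * L 0) ↔
          t = fun k : Fin m => x ^ p ^ (k : ℕ) * L 0 - L k.succ := by
      simp only [funext_iff, eq_sub_iff_add_eq']
    simp only [Fintype.sum_sum_type, Matrix.fromBlocks_apply₂₂, Matrix.fromBlocks_apply₂₁,
      Matrix.zero_apply, sum_const_zero, add_zero, wengerIncMatrix, Matrix.transpose_apply,
      Matrix.of_apply, Fintype.sum_fin_cons, Fin.cons_succ, Fin.cons_zero, key, sum_ite_eq',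
      mem_univ, if_true]
    simp

/-- The number of lines through two points depends only on their difference `u`: a line through
both is determined by its first coordinate `l`. -/
theorem wengerIncMatrix_mul_transpose [Fact p.Prime] [CharP F p] :
    wengerIncMatrix F p m * (wengerIncMatrix F p m)ᵀ = Matrix.of fun P P' =>
      (fun u : Fin (m + 1) → F =>
        ∑ l : F, if ∀ k : Fin m, u k.succ = u 0 ^ p ^ (k : ℕ) * l then (1 : ℝ) else 0) (P - P') := by
  ext P P'
  simp only [Matrix.mul_apply, Matrix.transpose_apply, wengerIncMatrix, Matrix.of_apply,
    Fintype.sum_fin_cons, Fin.cons_succ, Fin.cons_zero, Pi.sub_apply]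
  refine sum_congr rfl fun l _ => ?_
  have key (t : Fin m → F) : (∀ k : Fin m, t k + P k.succ = P 0 ^ p ^ (k : ℕ) * l) ↔
      t = fun k : Fin m => P 0 ^ p ^ (k : ℕ) * l - P k.succ := by
    simp only [funext_iff, eq_sub_iff_add_eq]
  simp only [key, ite_mul, one_mul, zero_mul, sum_ite_eq', mem_univ, if_true]
  refine if_congr (forall_congr' fun k => ?_) rfl rfl
  rw [sub_pow_char_pow, sub_mul]
  constructor <;> intro h <;> linear_combination -h

variable [Fact p.Prime] [CharP F p] [Algebra (ZMod p) F]

open Classical in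
/-- The eigenvalue of `N * Nᵀ`, for the incidence matrix `N`, that belongs to the additive
character `u ↦ ψ (c ⬝ᵥ u)`. With `K` the kernel of the linearized polynomial whose coefficients are
`c 1, c 2, ...`, it is `|F| * |K|` if `x ↦ ψ (c 0 * x)` is trivial on `K`, and `0` otherwise. -/
noncomputable def wengerSqEigenvalue (p : ℕ) [Fact p.Prime] [CharP F p] [Algebra (ZMod p) F]
    (ψ : AddChar F ℂ) (c : Fin (m + 1) → F) : ℝ :=
  if ∀ x ∈ LinearMap.ker (linearizedPolynomialMap F p m (Fin.tail c)), ψ (c 0 * x) = 1 then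
    Fintype.card F * Nat.card (LinearMap.ker (linearizedPolynomialMap F p m (Fin.tail c)))
  else 0

/-- The Fourier coefficient at `c` is `∑ x, ψ (c 0 * x) * ∑ l, ψ (l * φ x)`, for the linearized
polynomial `φ` of `Fin.tail c`. The sum over `l` restricts `x` to the kernel of `φ`, on which the
sum of the character `x ↦ ψ (c 0 * x)` is then taken. -/
theorem sum_mul_addChar_eq_wengerSqEigenvalue {ψ : AddChar F ℂ} (hψ : ψ.IsPrimitive)
    (c : Fin (m + 1) → F) :
    ∑ u : Fin (m + 1) → F,
        ((∑ l : F, if ∀ k : Fin m, u k.succ = u 0 ^ p ^ (k : ℕ) * l then (1 : ℝ) else 0 : ℝ) : ℂ) *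
          ψ (c ⬝ᵥ u) = wengerSqEigenvalue p ψ c := by
  classical
  set φ := linearizedPolynomialMap F p m (Fin.tail c) with hφ
  have h1 (x l : F) : ∑ t : Fin m → F,
      (if ∀ k : Fin m, t k = x ^ p ^ (k : ℕ) * l then (1 : ℂ) else 0) *
        ψ (c ⬝ᵥ (Fin.cons x t : Fin (m + 1) → F)) = ψ (c 0 * x) * ψ (l * φ x) := by
    simp only [← funext_iff, ite_mul, one_mul, zero_mul]
    rw [← AddChar.map_add_eq_mul, sum_ite_eq' univ (fun k : Fin m => x ^ p ^ (k : ℕ) * l),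
      if_pos (mem_univ _), hφ, linearizedPolynomialMap_apply]
    congr 1
    simp only [dotProduct, Fin.sum_univ_succ, Fin.cons_zero, Fin.cons_succ, mul_sum, Fin.tail]
    congr 1
    exact sum_congr rfl fun k _ => by ring
  have h2 (x : F) : ∑ l : F, ψ (l * φ x) = if φ x = 0 then (Fintype.card F : ℂ) else 0 := by
    simpa using AddChar.sum_mulShift (φ x) hψ
  have h3 : ∑ u : Fin (m + 1) → F,
      ((∑ l : F, if ∀ k : Fin m, u k.succ = u 0 ^ p ^ (k : ℕ) * l then (1 : ℝ) else 0 : ℝ) : ℂ) *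
        ψ (c ⬝ᵥ u) = ∑ x : F, ψ (c 0 * x) * if φ x = 0 then (Fintype.card F : ℂ) else 0 := by
    rw [Fintype.sum_fin_cons]
    refine sum_congr rfl fun x _ => ?_
    rw [← h2, mul_sum, ← sum_congr rfl fun l _ => h1 x l, sum_comm]
    refine sum_congr rfl fun t _ => ?_
    rw [← sum_mul]
    simp only [Fin.cons_succ, Fin.cons_zero]
    push_cast [apply_ite (Complex.ofReal)]
    rfl
  let χ : AddChar (LinearMap.ker φ) ℂ :=
    (AddChar.mulShift ψ (c 0)).compAddMonoidHom (LinearMap.ker φ).subtype.toAddMonoidHom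
  have hχ : χ = 0 ↔ ∀ x ∈ LinearMap.ker φ, ψ (c 0 * x) = 1 := by
    rw [DFunLike.ext_iff, Subtype.forall]; rfl
  have h4 : ∑ x : F, ψ (c 0 * x) * (if φ x = 0 then (Fintype.card F : ℂ) else 0) =
      Fintype.card F * ∑ x : LinearMap.ker φ, χ x := by
    simp only [mul_ite, mul_zero]
    rw [← sum_filter, mul_sum]
    refine (sum_subtype _ (p := (· ∈ LinearMap.ker φ)) (F := inferInstance) (by simp) _).trans ?_
    exact sum_congr rfl fun x _ => mul_comm _ _
  rw [h3, h4, AddChar.sum_eq_ite, wengerSqEigenvalue, ← hφ, Nat.card_eq_fintype_card]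
  simp only [hχ]
  split_ifs <;> simp

open Polynomial in
theorem charpoly_adjMatrix_linearizedWengerGraph [DecidableRel (linearizedWengerGraph F p m).Adj]
    {ψ : AddChar F ℂ} (hψ : ψ.IsPrimitive) :
    ((linearizedWengerGraph F p m).adjMatrix ℝ).charpoly =
      ∏ c : Fin (m + 1) → F, (X ^ 2 - C (wengerSqEigenvalue p ψ c)) := by
  have h : (wengerIncMatrix F p m * (wengerIncMatrix F p m)ᵀ).charpoly =
      ∏ c : Fin (m + 1) → F, (X - C (wengerSqEigenvalue p ψ c)) := by
    apply map_injective Complex.ofRealHom Complex.ofReal_injective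
    rw [← Matrix.charpoly_map, wengerIncMatrix_mul_transpose]
    have h' := Matrix.charpoly_translationInvariant hψ fun u : Fin (m + 1) → F =>
      ((∑ l : F, if ∀ k : Fin m, u k.succ = u 0 ^ p ^ (k : ℕ) * l then (1 : ℝ) else 0 : ℝ) : ℂ)
    simp only [sum_mul_addChar_eq_wengerSqEigenvalue hψ] at h'
    simp only [Polynomial.map_prod, Polynomial.map_sub, map_X, map_C, Complex.ofRealHom_eq_coe]
    exact h'
  rw [adjMatrix_linearizedWengerGraph, Matrix.charpoly_fromBlocks_zero_diagonal, h,
    Polynomial.prod_comp]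
  simp

end CharacteristicPolynomial

/-! ### Multiplicities of the eigenvalues -/

section Multiplicity

theorem pow_sub_pow_pos_of_lt {p n j : ℕ} (hp : p.Prime) (h : j < n) :
    (0 : ℚ) < (p : ℚ) ^ n - (p : ℚ) ^ j :=
  sub_pos.mpr (pow_lt_pow_right₀ (mod_cast hp.one_lt) h)

theorem wengerRankCount_pos {p : ℕ} (hp : p.Prime) (e i : ℕ) : 0 < wengerRankCount p e i := by
  refine div_pos (prod_pos fun j hj => pow_pos (pow_sub_pow_pos_of_lt hp ?_) 2)
    (prod_pos fun j hj => pow_sub_pow_pos_of_lt hp (mem_range.mp hj))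
  have := mem_range.mp hj
  omega

variable {F : Type*} [Field F] [Fintype F] {p e m : ℕ} [Fact p.Prime] [Algebra (ZMod p) F]

/-- The products in `wengerRankCount` are the numbers of independent families of `e - i` vectors in
spaces of dimension `e` and `e - i`. -/
theorem card_finrank_ker_eq_wengerRankCount (hF : Fintype.card F = p ^ e) {i : ℕ} (hi : i ≤ e) :
    (Nat.card {f : F →ₗ[ZMod p] F // Module.finrank (ZMod p) (LinearMap.ker f) = i} : ℚ) =
      wengerRankCount p e i := by
  have hfr := finrank_zmod_eq_of_card_eq hF
  have hp : p.Prime := Fact.out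
  have hker (f : F →ₗ[ZMod p] F) : Module.finrank (ZMod p) (LinearMap.ker f) = i ↔
      Module.finrank (ZMod p) (LinearMap.range f) = e - i := by
    have := f.finrank_range_add_finrank_ker
    omega
  have h := card_linearMap_finrank_range_eq (K := ZMod p) (V := F) (W := F) (r := e - i)
    (by omega) (by omega)
  simp only [← hker, ZMod.card, hfr] at h
  have hcast {n : ℕ} (hn : e - i ≤ n) :
      ((∏ j : Fin (e - i), (p ^ n - p ^ (j : ℕ)) : ℕ) : ℚ) =
        ∏ j ∈ range (e - i), ((p : ℚ) ^ n - (p : ℚ) ^ j) := by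
    rw [prod_range, Nat.cast_prod]
    refine prod_congr rfl fun j _ => ?_
    rw [Nat.cast_sub (Nat.pow_le_pow_right hp.pos (by omega)), Nat.cast_pow, Nat.cast_pow]
  have h' := congrArg (Nat.cast (R := ℚ)) h
  rw [Nat.cast_mul, Nat.cast_mul, hcast le_rfl, hcast (by omega : e - i ≤ e)] at h'
  rw [wengerRankCount, eq_div_iff, h', prod_pow, sq]
  exact (prod_pos fun j hj => pow_sub_pow_pos_of_lt hp (mem_range.mp hj)).ne'

theorem card_addChar_trivial_on_ker [DecidableEq F] {ψ : AddChar F ℂ} (hψ : ψ.IsPrimitive)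
    (hF : Fintype.card F = p ^ e) (f : F →ₗ[ZMod p] F) :
    Nat.card {a : F // ∀ x ∈ LinearMap.ker f, ψ (a * x) = 1} =
      p ^ (e - Module.finrank (ZMod p) (LinearMap.ker f)) := by
  have hp : p.Prime := Fact.out
  have h := AddChar.card_trivial_mul_card hψ (LinearMap.ker f).toAddSubgroup
  have hk : Nat.card (LinearMap.ker f).toAddSubgroup =
      p ^ Module.finrank (ZMod p) (LinearMap.ker f) := by
    have := Module.natCard_eq_pow_finrank (K := ZMod p) (V := LinearMap.ker f)
    rwa [Nat.card_zmod] at this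
  have hle : Module.finrank (ZMod p) (LinearMap.ker f) ≤ e :=
    finrank_zmod_eq_of_card_eq hF ▸ Submodule.finrank_le _
  rw [hk, hF, ← Nat.sub_add_cancel hle, pow_add] at h
  exact Nat.eq_of_mul_eq_mul_right (pow_pos hp.pos _) h

variable [CharP F p]

theorem card_linearizedPolynomialMap_finrank_ker_eq (hF : Fintype.card F = p ^ e) (hm : e ≤ m)
    {i : ℕ} (hi : i ≤ e) :
    (Nat.card {w : Fin m → F //
        Module.finrank (ZMod p) (LinearMap.ker (linearizedPolynomialMap F p m w)) = i} : ℚ) =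
      ((p : ℚ) ^ e) ^ (m - e) * wengerRankCount p e i := by
  have hp : p.Prime := Fact.out
  have hp0 : (p : ℚ) ≠ 0 := mod_cast hp.ne_zero
  have : Finite (F →ₗ[ZMod p] F) := Finite.of_injective _ DFunLike.coe_injective
  have h := AddMonoidHom.card_subtype_comp_mul_card (linearizedPolynomialMap F p m)
    (linearizedPolynomialMap_surjective hF hm)
    fun f => Module.finrank (ZMod p) (LinearMap.ker f) = i
  have hfr := finrank_zmod_eq_of_card_eq hF
  rw [Module.natCard_eq_pow_finrank (K := ZMod p) (V := F →ₗ[ZMod p] F),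
      Module.finrank_linearMap, hfr, Nat.card_fun, Nat.card_zmod, Nat.card_eq_fintype_card (α := F),
      hF, Nat.card_eq_fintype_card (α := Fin m), Fintype.card_fin] at h
  have h' := congrArg (Nat.cast (R := ℚ)) h
  push_cast at h'
  rw [card_finrank_ker_eq_wengerRankCount hF hi] at h'
  obtain ⟨d, rfl⟩ := Nat.exists_eq_add_of_le hm
  rw [pow_add ((p : ℚ) ^ e) e d, ← pow_mul (p : ℚ) e e, mul_comm, mul_assoc] at h'
  rw [Nat.add_sub_cancel_left]
  exact mul_left_cancel₀ (pow_ne_zero _ hp0) h'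

theorem wengerSqEigenvalue_cons (hF : Fintype.card F = p ^ e) (ψ : AddChar F ℂ) (a : F)
    (w : Fin m → F) [Decidable (∀ x ∈ LinearMap.ker (linearizedPolynomialMap F p m w),
      ψ (a * x) = 1)] :
    wengerSqEigenvalue p ψ (Fin.cons a w : Fin (m + 1) → F) =
      if ∀ x ∈ LinearMap.ker (linearizedPolynomialMap F p m w), ψ (a * x) = 1 then
        (p : ℝ) ^ e *
          (p : ℝ) ^ Module.finrank (ZMod p) (LinearMap.ker (linearizedPolynomialMap F p m w))
      else 0 := by
  rw [wengerSqEigenvalue, Fin.tail_cons, Fin.cons_zero, hF,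
    Module.natCard_eq_pow_finrank (K := ZMod p), Nat.card_zmod]
  push_cast
  congr

variable [DecidableEq F]

/-- Each `w` whose linearized polynomial has a kernel of dimension `i` contributes the `p ^ (e - i)`
elements `a` for which `x ↦ ψ (a * x)` is trivial on the kernel; no other `w` contributes. -/
theorem card_wengerSqEigenvalue_eq_pow {ψ : AddChar F ℂ} (hψ : ψ.IsPrimitive)
    (hF : Fintype.card F = p ^ e) (hm : e ≤ m) {i : ℕ} (hi : i ≤ e) :
    (#{c : Fin (m + 1) → F | wengerSqEigenvalue p ψ c = (p : ℝ) ^ e * (p : ℝ) ^ i} : ℚ) =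
      ((p : ℚ) ^ e) ^ (m - e) * ((p : ℚ) ^ (e - i) * wengerRankCount p e i) := by
  classical
  have hp : p.Prime := Fact.out
  have hp0 : (p : ℝ) ≠ 0 := mod_cast hp.ne_zero
  have hinj (j : ℕ) : (p : ℝ) ^ e * (p : ℝ) ^ j = (p : ℝ) ^ e * (p : ℝ) ^ i ↔ j = i := by
    rw [mul_right_inj' (pow_ne_zero _ hp0)]
    exact_mod_cast (Nat.pow_right_injective hp.two_le).eq_iff
  have key (w : Fin m → F) :
      (∑ a : F, if wengerSqEigenvalue p ψ (Fin.cons a w : Fin (m + 1) → F) =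
        (p : ℝ) ^ e * (p : ℝ) ^ i then (1 : ℚ) else 0) =
      if Module.finrank (ZMod p) (LinearMap.ker (linearizedPolynomialMap F p m w)) = i then
        (p : ℚ) ^ (e - i) else 0 := by
    rw [sum_boole]
    simp only [wengerSqEigenvalue_cons hF]
    have h := card_addChar_trivial_on_ker hψ hF (linearizedPolynomialMap F p m w)
    rw [Nat.card_eq_fintype_card, Fintype.card_subtype] at h
    split_ifs with hw
    · rw [hw] at h ⊢
      rw [← Nat.cast_pow (α := ℚ), ← h]
      congr 2
      ext a
      simp [hp0]
    · rw [Nat.cast_eq_zero, card_eq_zero, filter_eq_empty_iff]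
      intro a _
      split_ifs
      · rwa [hinj]
      · exact (mul_ne_zero (pow_ne_zero _ hp0) (pow_ne_zero _ hp0)).symm
  rw [← sum_boole, Fintype.sum_fin_cons, sum_comm, sum_congr rfl fun w _ => key w, ← sum_filter,
    sum_const, nsmul_eq_mul, ← Fintype.card_subtype, ← Nat.card_eq_fintype_card,
    card_linearizedPolynomialMap_finrank_ker_eq hF hm hi]
  ring

/-- Each `w` whose linearized polynomial has a kernel of dimension `i` contributes the elements `a`
for which `x ↦ ψ (a * x)` is not trivial on the kernel, `p ^ e - p ^ (e - i)` in number. -/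
theorem card_wengerSqEigenvalue_eq_zero {ψ : AddChar F ℂ} (hψ : ψ.IsPrimitive)
    (hF : Fintype.card F = p ^ e) (hm : e ≤ m) :
    (#{c : Fin (m + 1) → F | wengerSqEigenvalue p ψ c = 0} : ℚ) =
      ((p : ℚ) ^ e) ^ (m - e) *
        ∑ i ∈ Icc 1 e, ((p : ℚ) ^ e - (p : ℚ) ^ (e - i)) * wengerRankCount p e i := by
  classical
  have hp : p.Prime := Fact.out
  have hp0 : (p : ℝ) ≠ 0 := mod_cast hp.ne_zero
  let k (w : Fin m → F) := Module.finrank (ZMod p) (LinearMap.ker (linearizedPolynomialMap F p m w))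
  have key (w : Fin m → F) :
      (∑ a : F, if wengerSqEigenvalue p ψ (Fin.cons a w : Fin (m + 1) → F) = 0 then (1 : ℚ)
        else 0) = (p : ℚ) ^ e - (p : ℚ) ^ (e - k w) := by
    rw [sum_boole]
    simp only [wengerSqEigenvalue_cons hF]
    have h := card_addChar_trivial_on_ker hψ hF (linearizedPolynomialMap F p m w)
    rw [Nat.card_eq_fintype_card, Fintype.card_subtype] at h
    have h2 := card_filter_add_card_filter_not (s := (univ : Finset F))
      fun a => ∀ x ∈ LinearMap.ker (linearizedPolynomialMap F p m w), ψ (a * x) = 1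
    rw [card_univ, hF, h] at h2
    rw [eq_sub_iff_add_eq']
    convert congrArg (Nat.cast (R := ℚ)) h2 using 1
    · push_cast
      congr 3
      ext a
      simp [hp0]
    · simp
  have hk (w : Fin m → F) (_ : w ∈ univ) : k w ∈ range (e + 1) := by
    rw [mem_range, Nat.lt_succ_iff, ← finrank_zmod_eq_of_card_eq hF]
    exact Submodule.finrank_le _
  rw [← sum_boole, Fintype.sum_fin_cons, sum_comm, sum_congr rfl fun w _ => key w,
    ← sum_fiberwise_of_maps_to hk, sum_range_eq_add_Ico _ (Nat.succ_pos e)]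
  have hIco : Ico 1 (e + 1) = Icc 1 e := by ext; simp
  have h0 : ∑ w with k w = 0, ((p : ℚ) ^ e - (p : ℚ) ^ (e - k w)) = 0 :=
    sum_eq_zero fun w hw => by rw [(mem_filter.mp hw).2]; simp
  rw [h0, zero_add, hIco, mul_sum]
  refine sum_congr rfl fun i hi => ?_
  rw [sum_congr rfl fun w hw => by rw [(mem_filter.mp hw).2], sum_const, nsmul_eq_mul,
    ← Fintype.card_subtype, ← Nat.card_eq_fintype_card,
    card_linearizedPolynomialMap_finrank_ker_eq hF hm (mem_Icc.mp hi).2]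
  ring

end Multiplicity

theorem mainTheorem2 {F : Type*} [Field F] [Fintype F] [DecidableEq F]
    (p e m : ℕ) (hp : p.Prime) (hF : Fintype.card F = p ^ e) (hm : e ≤ m)
    [DecidableRel (linearizedWengerGraph F p m).Adj] :
    Nat.card (linearizedWengerGraph F p m).ConnectedComponent = (p ^ e) ^ (m - e) ∧
    {x : ℝ | Module.End.HasEigenvalue
        (Matrix.toLin' ((linearizedWengerGraph F p m).adjMatrix ℝ)) x} =
      {x : ℝ | x = 0 ∨ ∃ i : ℕ, i ≤ e ∧
        (x = Real.sqrt ((p : ℝ) ^ e * (p : ℝ) ^ i) ∨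
          x = -Real.sqrt ((p : ℝ) ^ e * (p : ℝ) ^ i))} ∧
    (∀ i : ℕ, i ≤ e →
      ((((linearizedWengerGraph F p m).adjMatrix ℝ).charpoly.rootMultiplicity
          (Real.sqrt ((p : ℝ) ^ e * (p : ℝ) ^ i)) : ℕ) : ℚ) =
        ((p : ℚ) ^ e) ^ (m - e) * ((p : ℚ) ^ (e - i) * wengerRankCount p e i) ∧
      ((((linearizedWengerGraph F p m).adjMatrix ℝ).charpoly.rootMultiplicity
          (-Real.sqrt ((p : ℝ) ^ e * (p : ℝ) ^ i)) : ℕ) : ℚ) =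
        ((p : ℚ) ^ e) ^ (m - e) * ((p : ℚ) ^ (e - i) * wengerRankCount p e i)) ∧
    ((((linearizedWengerGraph F p m).adjMatrix ℝ).charpoly.rootMultiplicity 0 : ℕ) : ℚ) =
      2 * (((p : ℚ) ^ e) ^ (m - e) *
        ∑ i ∈ Icc 1 e, ((p : ℚ) ^ e - (p : ℚ) ^ (e - i)) * wengerRankCount p e i) := by
  have : Fact p.Prime := ⟨hp⟩
  have : CharP F p := charP_of_card_eq_prime_pow hF
  let _ : Algebra (ZMod p) F := ZMod.algebra F p
  have hψ := AddChar.FiniteField.primitiveChar_to_Complex_isPrimitive F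
  set ψ := AddChar.FiniteField.primitiveChar_to_Complex F
  set A := (linearizedWengerGraph F p m).adjMatrix ℝ
  have hp0 : (0 : ℝ) < p := mod_cast hp.pos
  -- A field has at least two elements.
  have he : 1 ≤ e := by
    by_contra h
    have := Fintype.one_lt_card (α := F)
    rw [hF, Nat.lt_one_iff.mp (not_le.mp h), pow_zero] at this
    exact lt_irrefl _ this
  have hmult (μ : ℝ) : A.charpoly.rootMultiplicity μ = (if μ = 0 then 2 else 1) *
      #{c : Fin (m + 1) → F | wengerSqEigenvalue p ψ c = μ ^ 2} := by
    rw [charpoly_adjMatrix_linearizedWengerGraph hψ,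
      Polynomial.rootMultiplicity_prod_X_sq_sub_C]
  have hpos (i : ℕ) : (0 : ℝ) < (p : ℝ) ^ e * (p : ℝ) ^ i := by positivity
  have hsq (i : ℕ) : √((p : ℝ) ^ e * (p : ℝ) ^ i) ^ 2 = (p : ℝ) ^ e * (p : ℝ) ^ i :=
    Real.sq_sqrt (hpos i).le
  have hmul_pow (i : ℕ) (hi : i ≤ e) :
      ((A.charpoly.rootMultiplicity √((p : ℝ) ^ e * (p : ℝ) ^ i) : ℕ) : ℚ) =
        ((p : ℚ) ^ e) ^ (m - e) * ((p : ℚ) ^ (e - i) * wengerRankCount p e i) ∧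
      ((A.charpoly.rootMultiplicity (-√((p : ℝ) ^ e * (p : ℝ) ^ i)) : ℕ) : ℚ) =
        ((p : ℚ) ^ e) ^ (m - e) * ((p : ℚ) ^ (e - i) * wengerRankCount p e i) := by
    have h0 : √((p : ℝ) ^ e * (p : ℝ) ^ i) ≠ 0 := (Real.sqrt_pos.mpr (hpos i)).ne'
    rw [hmult, hmult, if_neg h0, if_neg (neg_ne_zero.mpr h0), neg_sq, hsq, one_mul,
      card_wengerSqEigenvalue_eq_pow hψ hF hm hi]
    exact ⟨rfl, rfl⟩
  have hmul_zero : ((A.charpoly.rootMultiplicity 0 : ℕ) : ℚ) =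
      2 * (((p : ℚ) ^ e) ^ (m - e) *
        ∑ i ∈ Icc 1 e, ((p : ℚ) ^ e - (p : ℚ) ^ (e - i)) * wengerRankCount p e i) := by
    rw [hmult, if_pos rfl, Nat.cast_mul, zero_pow two_ne_zero,
      card_wengerSqEigenvalue_eq_zero hψ hF hm, Nat.cast_ofNat]
  refine ⟨?_, ?_, hmul_pow, hmul_zero⟩
  · -- The graph is `q`-regular, so its Laplacian is `q - A`, and its kernel is the eigenspace of
    -- `A` for the eigenvalue `q = √(q * p ^ e)`.
    have hlap : LinearMap.ker ((linearizedWengerGraph F p m).lapMatrix ℝ).toLin' =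
        Module.End.eigenspace (Matrix.toLin' A) ((p : ℝ) ^ e) := by
      have hdeg : (linearizedWengerGraph F p m).degMatrix ℝ = Matrix.scalar _ ((p : ℝ) ^ e) := by
        rw [SimpleGraph.degMatrix, Matrix.scalar_apply]
        congr 1
        ext v
        rw [degree_linearizedWengerGraph, hF, Nat.cast_pow]
      ext x
      rw [LinearMap.mem_ker, Module.End.mem_eigenspace_iff, Matrix.toLin'_apply,
        Matrix.toLin'_apply, SimpleGraph.lapMatrix, hdeg, Matrix.sub_mulVec, sub_eq_zero, eq_comm,
        Matrix.scalar_apply, Matrix.diagonal_const_mulVec]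
    have hq : (p : ℝ) ^ e = √((p : ℝ) ^ e * (p : ℝ) ^ e) :=
      (Real.sqrt_mul_self (pow_pos hp0 e).le).symm
    have h := (hmul_pow e le_rfl).1
    rw [← hq, wengerRankCount, Nat.sub_self, pow_zero, range_zero, prod_empty, prod_empty, div_one,
      mul_one, mul_one] at h
    classical
    have hc := (linearizedWengerGraph F p m).card_connectedComponent_eq_finrank_ker_toLin'_lapMatrix
    rw [hlap, Matrix.finrank_eigenspace_eq_rootMultiplicity A (SimpleGraph.isSymm_adjMatrix _),
      ← Nat.card_eq_fintype_card] at hc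
    rw [hc]
    exact_mod_cast h
  · ext μ
    have hev : Module.End.HasEigenvalue (Matrix.toLin' A) μ ↔
        0 < A.charpoly.rootMultiplicity μ := by
      rw [Module.End.hasEigenvalue_iff_isRoot_charpoly, Matrix.charpoly_toLin',
        Polynomial.rootMultiplicity_pos A.charpoly_monic.ne_zero]
    rw [Set.mem_ofPred_eq, Set.mem_ofPred_eq, hev]
    have hr (i : ℕ) := wengerRankCount_pos hp e i
    have hpQ : (0 : ℚ) < p := mod_cast hp.pos
    constructor
    · intro h
      rw [hmult] at h
      obtain ⟨c, hc⟩ := card_pos.mp (Nat.pos_of_mul_pos_left h)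
      replace hc := (mem_filter.mp hc).2
      rw [← Fin.cons_self_tail c] at hc
      classical
      rw [wengerSqEigenvalue_cons hF] at hc
      split_ifs at hc
      · refine Or.inr ⟨_, ?_, sq_eq_sq_iff_eq_or_eq_neg.mp (hc.symm.trans (hsq _).symm)⟩
        exact (Submodule.finrank_le _).trans_eq (finrank_zmod_eq_of_card_eq hF)
      · exact Or.inl (pow_eq_zero_iff two_ne_zero |>.mp hc.symm)
    · rintro (rfl | ⟨i, hi, rfl | rfl⟩)
      · rw [← Nat.cast_pos (α := ℚ), hmul_zero]
        have : 0 < ∑ i ∈ Icc 1 e, ((p : ℚ) ^ e - (p : ℚ) ^ (e - i)) * wengerRankCount p e i := by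
          refine sum_pos (fun i hi => mul_pos (pow_sub_pow_pos_of_lt hp ?_) (hr i))
            ⟨e, mem_Icc.mpr ⟨he, le_rfl⟩⟩
          have := mem_Icc.mp hi
          omega
        positivity
      · rw [← Nat.cast_pos (α := ℚ), (hmul_pow i hi).1]
        have := hr i
        positivity
      · rw [← Nat.cast_pos (α := ℚ), (hmul_pow i hi).2]
        have := hr i
        positivity
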